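/- Let $Z(t)=e^{i\vartheta(t)}\zeta(\tfrac12+it)$ be the Hardy function, where $\vartheta(t)=\operatorname{Im}\log\Gamma(\tfrac14+\tfrac{it}{2})-\tfrac{t}{2}\log\pi$ is the Riemann–Siegel theta function. Assume the Riemann Hypothesis, and let $\alpha>0$ be a real number. Then there is a real number $T=T(\alpha)$ with the following property. Let $0<\gamma'<\gamma''$ be the ordinates of neighbouring zeros of the Riemann zeta function, i.e. $\zeta(\tfrac12+i\gamma')=\zeta(\tfrac12+i\gamma'')=0$ and $\zeta(\tfrac12+it)\ne 0$ for $\gamma'<t<\gamma''$. Let $\tilde t_0\ge T$ be a point with $\gamma'<\tilde t_0<\gamma''$, $Z'(\tilde t_0)=0$ and $\left|\zeta(\tfrac12+i\tilde t_0)\right|>\tilde t_0^{-\alpha}$. Then $$\Delta(\tilde t_0)=\min\{\tilde t_0-\gamma',\ \gamma''-\tilde t_0\}>(\gamma')^{-\alpha}.$$ -/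

import Mathlib

/-- The phase `e^{iϑ(t)}` of the Riemann-Siegel theta function
`ϑ(t) = Im log Γ(1/4 + it/2) - (t/2) log π`, that is
`e^{iϑ(t)} = π^{-it/2} Γ(1/4 + it/2) / |Γ(1/4 + it/2)|`. -/
noncomputable def siegelPhase (t : ℝ) : ℂ :=
  (Real.pi : ℂ) ^ (-(Complex.I * t / 2)) *
    (Complex.Gamma (1 / 4 + Complex.I * t / 2) / ‖Complex.Gamma (1 / 4 + Complex.I * t / 2)‖)

/-- The Hardy function `Z(t) = e^{iϑ(t)} ζ(1/2 + it)`. The product is real for every real `t`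
(see `hardyZ_eq`), so taking the real part loses nothing. -/
noncomputable def hardyZ (t : ℝ) : ℝ :=
  (siegelPhase t * riemannZeta (1 / 2 + Complex.I * t)).re

theorem siegelPhase_mul_zeta_eq (t : ℝ) :
    siegelPhase t * riemannZeta (1 / 2 + Complex.I * t) =
      (((Real.pi ^ (1 / 4 : ℝ) / ‖Complex.Gamma (1 / 4 + Complex.I * t / 2)‖ : ℝ)) : ℂ) *
        completedRiemannZeta (1 / 2 + Complex.I * t) := by
  have hs : (1 / 2 + Complex.I * t : ℂ) ≠ 0 := by
    intro h
    have := congrArg Complex.re h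
    norm_num at this
  have hG : Complex.Gammaℝ (1 / 2 + Complex.I * t) ≠ 0 :=
    Complex.Gammaℝ_ne_zero_of_re_pos (by norm_num)
  have hpi : (Real.pi : ℂ) ≠ 0 := by exact_mod_cast Real.pi_ne_zero
  have hL : completedRiemannZeta (1 / 2 + Complex.I * t) =
      Complex.Gammaℝ (1 / 2 + Complex.I * t) * riemannZeta (1 / 2 + Complex.I * t) := by
    rw [riemannZeta_def_of_ne_zero hs, mul_div_cancel₀ _ hG]
  have hp : (Real.pi : ℂ) ^ (-(Complex.I * t / 2)) =
      ((Real.pi ^ (1 / 4 : ℝ) : ℝ) : ℂ) * (Real.pi : ℂ) ^ (-(1 / 2 + Complex.I * t) / 2) := by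
    rw [Complex.ofReal_cpow Real.pi_pos.le, ← Complex.cpow_add _ _ hpi]
    congr 1
    push_cast
    ring
  have hg : (1 / 2 + Complex.I * t : ℂ) / 2 = 1 / 4 + Complex.I * t / 2 := by ring
  rw [hL, Complex.Gammaℝ_def, siegelPhase, hp, hg]
  push_cast
  ring

theorem completedRiemannZeta_critical_conj (t : ℝ) :
    (starRingEnd ℂ) (completedRiemannZeta (1 / 2 + Complex.I * t)) =
      completedRiemannZeta (1 / 2 + Complex.I * t) := by
  set s : ℂ := 1 / 2 + Complex.I * t with hsdef
  have hc : (starRingEnd ℂ) s = 1 - s := by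
    apply Complex.ext <;> simp [hsdef]
    norm_num
  have hre : s.re = 1 / 2 := by simp [hsdef]
  have key : ∀ z : ℂ, z.re = 1 / 2 →
      completedRiemannZeta z = Complex.Gammaℝ z * riemannZeta z := by
    intro z hz
    have h0 : z ≠ 0 := by
      rintro rfl
      norm_num at hz
    have hG : Complex.Gammaℝ z ≠ 0 :=
      Complex.Gammaℝ_ne_zero_of_re_pos (by rw [hz]; norm_num)
    rw [riemannZeta_def_of_ne_zero h0, mul_div_cancel₀ _ hG]
  have hGc : Complex.Gammaℝ ((starRingEnd ℂ) s) = (starRingEnd ℂ) (Complex.Gammaℝ s) := by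
    rw [Complex.Gammaℝ_def, Complex.Gammaℝ_def, map_mul, ← Complex.Gamma_conj]
    congr 1
    · have harg : (Real.pi : ℂ).arg ≠ Real.pi := by
        rw [Complex.arg_ofReal_of_nonneg Real.pi_pos.le]
        exact Real.pi_ne_zero.symm
      have h := Complex.cpow_conj (Real.pi : ℂ) (-s / 2) harg
      rw [Complex.conj_ofReal] at h
      rw [← h]
      simp [map_ofNat (starRingEnd ℂ) 2]
    · simp [map_ofNat (starRingEnd ℂ) 2]
  calc (starRingEnd ℂ) (completedRiemannZeta s)
      = completedRiemannZeta ((starRingEnd ℂ) s) := by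
        rw [key s hre, key _ (by rw [Complex.conj_re, hre]), hGc, riemannZeta_conj, map_mul]
    _ = completedRiemannZeta s := by rw [hc, completedRiemannZeta_one_sub]

/-- `Z(t) = e^{iϑ(t)} ζ(1/2 + it)` as complex numbers: the right-hand side is real. -/
theorem hardyZ_eq (t : ℝ) :
    (hardyZ t : ℂ) = siegelPhase t * riemannZeta (1 / 2 + Complex.I * t) := by
  apply Complex.conj_eq_iff_re.mp
  rw [siegelPhase_mul_zeta_eq, map_mul, Complex.conj_ofReal, completedRiemannZeta_critical_conj]

/-- `γ'` and `γ''` are the ordinates of neighbouring zeros `1/2 + iγ'`, `1/2 + iγ''` of the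
Riemann zeta function on the critical line, in the upper half plane: `0 < γ' < γ''`, both are
zeros, and there is no zero on the critical line strictly between them. -/
def NeighboringZetaZeros (γ' γ'' : ℝ) : Prop :=
  0 < γ' ∧ γ' < γ'' ∧
    riemannZeta (1 / 2 + Complex.I * γ') = 0 ∧
    riemannZeta (1 / 2 + Complex.I * γ'') = 0 ∧
    ∀ t : ℝ, γ' < t → t < γ'' → riemannZeta (1 / 2 + Complex.I * t) ≠ 0

/-! On the real axis `Z²` is the restriction of the analytic function `hardySq`. At a zero `γ` of
`Z` both `Z²` and its derivative vanish, and at a critical point `t₀` the derivative vanishes again.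
These are three Hermite conditions, so `Z(t₀)²` is at most a constant times `|t₀ - γ|³` times the
maximum of the third derivative (`norm_le_of_hermite_zeros`). Under RH that maximum is `O(t₀^ε)`, by
Cauchy's estimate and a Lindelöf bound valid slightly to the left of the critical line. If `|t₀ -
γ|` were at most `γ'^(-α)`, with `γ'` comparable to `t₀`, then `Z(t₀)²` would be `O(t₀^(ε - 3α))`.
For `ε = α/2` this contradicts `Z(t₀)² > t₀^(-2α)` once `t₀` is large.

The Lindelöf bound comes from polynomial growth of zeta. Where zeta has no zeros, Borel–Carathéodory
and three circles applied to its logarithm improve the growth to `τ^o(1)`; a second use of three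
circles, on zeta itself, carries this across the critical line.

That `γ'` is comparable to `t₀` follows from `RiemannHypothesis.exists_zero`: a long gap between
zeros would make zeta and its inverse `τ^o(1)` on both `re s = 0` and `re s = 1`, which the
functional equation forbids. -/

open Complex Set Metric Filter Topology

/-! ### Polynomial growth of zeta by the trapezoidal rule -/

/-- `(1 - s)` times the error of the trapezoidal rule for `∫ x ^ (-s)` on `[n + 1, n + 2]`. -/
noncomputable def trapezoidTerm (s : ℂ) (n : ℕ) : ℂ :=
  (1 - s) * (1 / ((n : ℂ) + 1) ^ s + 1 / ((n : ℂ) + 2) ^ s) / 2 -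
    (((n : ℂ) + 2) ^ (1 - s) - ((n : ℂ) + 1) ^ (1 - s))

/-- As a function of the right endpoint, the error and its first derivative vanish at `p`, while the
second derivative is `O(p ^ (-re s - 2))`. Two applications of the mean value inequality then
suffice. -/
theorem trapezoid_error_le {s : ℂ} (hs : -2 ≤ s.re) {p : ℝ} (hp : 0 < p) :
    ‖(1 - s) * ((p : ℂ) ^ (-s) + ((p + 1 : ℝ) : ℂ) ^ (-s)) / 2 -
      (((p + 1 : ℝ) : ℂ) ^ (1 - s) - (p : ℂ) ^ (1 - s))‖ ≤
      ‖1 - s‖ * ‖s‖ * ‖s + 1‖ * p ^ (-s.re - 2) := by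
  set K : ℝ := ‖1 - s‖ * ‖s‖ * ‖s + 1‖ * p ^ (-s.re - 2) with hK
  have hK0 : 0 ≤ K := by positivity
  have hd : ∀ (a : ℂ) (x : ℝ), p ≤ x →
      HasDerivAt (fun y : ℝ => (y : ℂ) ^ a) (a * (x : ℂ) ^ (a - 1)) x := by
    intro a x hx
    have hx0 : (x : ℂ) ∈ slitPlane := by
      simp [slitPlane, lt_of_lt_of_le hp hx]
    have := ((hasDerivAt_id (x : ℂ)).cpow_const (c := a) hx0).comp_ofReal
    simpa using this
  have hofr : ∀ x : ℝ, HasDerivAt (fun y : ℝ => (y : ℂ)) 1 x := fun x => ofRealCLM.hasDerivAt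
  set E1 : ℝ → ℂ := fun x => (1 - s) / 2 * ((p : ℂ) ^ (-s) - (x : ℂ) ^ (-s) -
    s * (x : ℂ) ^ (-s - 1) * (x - p)) with hE1
  set E : ℝ → ℂ := fun x => (1 - s) * ((p : ℂ) ^ (-s) + (x : ℂ) ^ (-s)) / 2 * (x - p) -
      ((x : ℂ) ^ (1 - s) - (p : ℂ) ^ (1 - s)) with hE
  have hE1d : ∀ x : ℝ, p ≤ x → HasDerivAt E1
      ((1 - s) / 2 * (s * (s + 1) * (x : ℂ) ^ (-s - 2) * (x - p))) x := by
    intro x hx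
    have h := ((((hd (-s) x hx).const_sub ((p : ℂ) ^ (-s))).sub
      (((hd (-s - 1) x hx).const_mul s).mul ((hofr x).sub_const (p : ℂ)))).const_mul ((1 - s) / 2))
    refine h.congr_deriv ?_
    rw [show -s - 1 - 1 = -s - 2 by ring]
    ring
  have hEd : ∀ x : ℝ, p ≤ x → HasDerivAt E (E1 x) x := by
    intro x hx
    have h := (((((hd (-s) x hx).const_add ((p : ℂ) ^ (-s))).const_mul (1 - s)).div_const 2).mul
      ((hofr x).sub_const (p : ℂ))).sub ((hd (1 - s) x hx).sub_const ((p : ℂ) ^ (1 - s)))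
    refine h.congr_deriv ?_
    rw [show 1 - s - 1 = -s by ring, hE1]
    ring
  have hE1b : ∀ x ∈ Icc p (p + 1), ‖E1 x‖ ≤ K := by
    have h := norm_image_sub_le_of_norm_deriv_le_segment' (f := E1) (C := K)
      (fun x (hx : x ∈ Icc p (p + 1)) => (hE1d x hx.1).hasDerivWithinAt) ?_
    · intro x hx
      have h2 := h x hx
      have h3 : E1 p = 0 := by simp [hE1]
      rw [h3, sub_zero] at h2
      nlinarith [hx.1, hx.2]
    · intro x hx
      have hx0 : 0 < x := lt_of_lt_of_le hp hx.1
      have e1 : ‖(x : ℂ) ^ (-s - 2)‖ ≤ p ^ (-s.re - 2) := by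
        rw [norm_cpow_eq_rpow_re_of_pos hx0]
        have : (-s - 2).re = -s.re - 2 := by simp
        rw [this]
        exact Real.rpow_le_rpow_of_nonpos hp hx.1 (by linarith)
      have e2 : ‖((x : ℂ) - p)‖ ≤ 1 := by
        rw [← ofReal_sub, norm_real, Real.norm_eq_abs, abs_of_nonneg (by linarith [hx.1])]
        linarith [hx.2]
      simp only [norm_mul, norm_div]
      rw [hK]
      have : ‖(2 : ℂ)‖ = 2 := by simp
      rw [this]
      calc ‖1 - s‖ / 2 * (‖s‖ * ‖s + 1‖ * ‖(x : ℂ) ^ (-s - 2)‖ * ‖(x : ℂ) - p‖)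
          ≤ ‖1 - s‖ / 1 * (‖s‖ * ‖s + 1‖ * p ^ (-s.re - 2) * 1) := by gcongr; norm_num
        _ = _ := by ring
  have h := norm_image_sub_le_of_norm_deriv_le_segment' (f := E) (C := K)
      (fun x (hx : x ∈ Icc p (p + 1)) => (hEd x hx.1).hasDerivWithinAt)
      (fun x hx => hE1b x (Ico_subset_Icc_self hx)) (p + 1) (by simp)
  have h3 : E p = 0 := by simp [hE]
  have h4 : E (p + 1) = (1 - s) * ((p : ℂ) ^ (-s) + ((p + 1 : ℝ) : ℂ) ^ (-s)) / 2 -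
      (((p + 1 : ℝ) : ℂ) ^ (1 - s) - (p : ℂ) ^ (1 - s)) := by
    simp [hE]
  rw [h3, sub_zero, h4] at h
  linarith

theorem norm_trapezoidTerm_le {s : ℂ} (hs : -(1 / 2) ≤ s.re) (n : ℕ) :
    ‖trapezoidTerm s n‖ ≤ ‖1 - s‖ * ‖s‖ * ‖s + 1‖ * ((n : ℝ) + 1) ^ (-(3 / 2) : ℝ) := by
  have h := trapezoid_error_le (s := s) (by linarith) (p := (n : ℝ) + 1) (by positivity)
  have e : ((((n : ℝ) + 1 + 1 : ℝ)) : ℂ) = (n : ℂ) + 2 := by push_cast; ring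
  have e' : ((((n : ℝ) + 1 : ℝ)) : ℂ) = (n : ℂ) + 1 := by push_cast; ring
  rw [e, e'] at h
  have e2 : ((n : ℝ) + 1) ^ (-s.re - 2) ≤ ((n : ℝ) + 1) ^ (-(3 / 2) : ℝ) :=
    Real.rpow_le_rpow_of_exponent_le (by linarith [Nat.cast_nonneg (α := ℝ) n]) (by linarith)
  rw [trapezoidTerm, one_div, one_div, ← cpow_neg, ← cpow_neg]
  exact h.trans (by gcongr)

theorem summable_natCast_add_one_rpow :
    Summable (fun n : ℕ => ((n : ℝ) + 1) ^ (-(3 / 2) : ℝ)) := by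
  have h := (summable_nat_add_iff (f := fun n : ℕ => (n : ℝ) ^ (-(3 / 2) : ℝ)) 1).2
    (Real.summable_nat_rpow.2 (by norm_num))
  simpa using h

/-- The endpoint values sum to two copies of the zeta series, one lacking its first term, and the
integrals telescope. -/
theorem hasSum_trapezoidTerm {s : ℂ} (hs : 1 < s.re) :
    HasSum (trapezoidTerm s) ((1 - s) * (riemannZeta s - 1 / 2) + 1) := by
  have hsum : Summable (trapezoidTerm s) :=
    Summable.of_norm_bounded (summable_natCast_add_one_rpow.mul_left _)
      (fun n => norm_trapezoidTerm_le (by linarith) n)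
  have hz : HasSum (fun n : ℕ => 1 / ((n : ℂ) + 1) ^ s) (riemannZeta s) := by
    rw [zeta_eq_tsum_one_div_nat_add_one_cpow hs]
    refine Summable.hasSum ?_
    have := (summable_nat_add_iff 1).2 (Complex.summable_one_div_nat_cpow.2 hs)
    simpa using this
  have hz2 : HasSum (fun n : ℕ => 1 / ((n : ℂ) + 2) ^ s) (riemannZeta s - 1) := by
    have := (hasSum_nat_add_iff' 1).2 hz
    simp only [Finset.sum_range_one, Nat.cast_zero, zero_add, one_cpow, div_one] at this
    have e : (fun n : ℕ => 1 / ((n : ℂ) + 2) ^ s) =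
        fun n : ℕ => 1 / (((n + 1 : ℕ) : ℂ) + 1) ^ s := by
      funext n
      rw [show ((n + 1 : ℕ) : ℂ) + 1 = n + 2 by push_cast; ring]
    rwa [e]
  refine hsum.hasSum_iff_tendsto_nat.2 ?_
  have h1 := (((hz.add hz2).mul_left ((1 - s) / 2)).tendsto_sum_nat)
  have ht : Tendsto (fun n : ℕ => ((n : ℂ) + 1) ^ (1 - s)) atTop (𝓝 0) := by
    rw [tendsto_zero_iff_norm_tendsto_zero]
    have : ∀ n : ℕ, ‖((n : ℂ) + 1) ^ (1 - s)‖ = ((n : ℝ) + 1) ^ (-(s.re - 1)) := by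
      intro n
      have : (n : ℂ) + 1 = (((n : ℝ) + 1 : ℝ) : ℂ) := by push_cast; ring
      rw [this, norm_cpow_eq_rpow_re_of_pos (by positivity)]
      simp
    simp_rw [this]
    exact (tendsto_rpow_neg_atTop (by linarith)).comp
      (tendsto_atTop_add_const_right _ _ tendsto_natCast_atTop_atTop)
  have h2 := h1.sub (ht.sub_const 1)
  convert h2 using 1
  · ext N
    have hT := Finset.sum_range_sub (fun n : ℕ => ((n : ℂ) + 1) ^ (1 - s)) N
    simp only [Nat.cast_zero, zero_add, one_cpow] at hT
    rw [← hT, ← Finset.sum_sub_distrib]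
    refine Finset.sum_congr rfl fun n _ => ?_
    rw [trapezoidTerm]
    push_cast
    rw [show (n : ℂ) + 1 + 1 = n + 2 by ring]
    ring
  · congr 1
    ring

/-- The identity theorem continues the formula from `re s > 1`. The factor `1 - s` in each term
removes the pole, so the half-plane need not be punctured at `1`. -/
theorem riemannZeta₁_eq_sub_tsum_trapezoidTerm {s : ℂ} (hs : -(1 / 2) < s.re) :
    riemannZeta₁ s = (s - 1) / 2 + 1 - ∑' n, trapezoidTerm s n := by
  set M : ℝ := ‖s‖ + 3 with hM
  have hM3 : 3 ≤ M := by linarith [norm_nonneg s]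
  -- Intersecting with a ball makes the polynomial factors in the term bound uniform; its radius
  -- leaves room for both `s` and the base point `2`.
  set U : Set ℂ := {w | -(1 / 2) < w.re} ∩ ball 0 M with hU
  have hUo : IsOpen U := (isOpen_lt continuous_const continuous_re).inter isOpen_ball
  have hUc : IsPreconnected U :=
    ((convex_halfSpace_re_gt _).inter (convex_ball _ _)).isPreconnected
  have hsum : DifferentiableOn ℂ (fun w => ∑' n, trapezoidTerm w n) U := by
    refine differentiableOn_tsum_of_summable_norm
      (summable_natCast_add_one_rpow.mul_left ((1 + M) * M * (M + 1))) (fun n => ?_) hUo ?_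
    · have h1 : (n : ℂ) + 1 ≠ 0 := by exact_mod_cast Nat.succ_ne_zero n
      have h2 : (n : ℂ) + 2 ≠ 0 := by exact_mod_cast Nat.succ_ne_zero (n + 1)
      refine Differentiable.differentiableOn fun w => ?_
      simp only [trapezoidTerm, one_div, ← cpow_neg]
      have a1 : ∀ c : ℂ, c ≠ 0 → DifferentiableAt ℂ (fun w => c ^ (-w)) w := fun c hc =>
        (differentiableAt_id.neg).const_cpow (Or.inl hc)
      have a2 : ∀ c : ℂ, c ≠ 0 → DifferentiableAt ℂ (fun w => c ^ (1 - w)) w := fun c hc =>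
        (differentiableAt_id.const_sub 1).const_cpow (Or.inl hc)
      exact ((((differentiableAt_id.const_sub 1).mul ((a1 _ h1).add (a1 _ h2))).div_const 2)).sub
        ((a2 _ h2).sub (a2 _ h1))
    · intro n w hw
      have hw2 : ‖w‖ ≤ M := (mem_ball_zero_iff.1 hw.2).le
      refine (norm_trapezoidTerm_le hw.1.le n).trans ?_
      have b1 : ‖1 - w‖ ≤ 1 + M := (norm_sub_le _ _).trans (by simpa using hw2)
      have b2 : ‖w + 1‖ ≤ M + 1 := (norm_add_le _ _).trans (by simpa using hw2)
      gcongr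
  have hL : AnalyticOnNhd ℂ riemannZeta₁ U :=
    differentiable_riemannZeta₁.differentiableOn.analyticOnNhd hUo
  have hR : AnalyticOnNhd ℂ (fun w => (w - 1) / 2 + 1 - ∑' n, trapezoidTerm w n) U :=
    DifferentiableOn.analyticOnNhd (DifferentiableOn.sub (by fun_prop) hsum) hUo
  have h2 : (2 : ℂ) ∈ U := by
    refine ⟨?_, ?_⟩
    · simp only [mem_ofPred_eq, re_ofNat]; norm_num
    · rw [mem_ball_zero_iff, norm_ofNat]
      linarith
  refine hL.eqOn_of_preconnected_of_eventuallyEq hR hUc h2 ?_ (?_ : s ∈ U)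
  · have : ∀ᶠ w : ℂ in 𝓝 2, 1 < w.re :=
      (isOpen_lt continuous_const continuous_re).mem_nhds (by simp)
    filter_upwards [this] with w hw
    have hw1 : w ≠ 1 := by rintro rfl; simp at hw
    have hw1' : w - 1 ≠ 0 := sub_ne_zero.2 hw1
    rw [(hasSum_trapezoidTerm hw).tsum_eq, riemannZeta_eq_inv_sub_mul hw1]
    field_simp
    ring
  · exact ⟨hs, by rw [mem_ball_zero_iff]; linarith⟩

/-- Polynomial growth of the zeta function to the right of the line `re s = -1/2`. -/
theorem exists_norm_riemannZeta_le :
    ∃ C : ℝ, 0 < C ∧ ∀ s : ℂ, -(1 / 2) < s.re → 1 ≤ ‖s - 1‖ →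
      ‖riemannZeta s‖ ≤ C * (1 + ‖s‖) ^ 3 := by
  set S := ∑' n : ℕ, ((n : ℝ) + 1) ^ (-(3 / 2) : ℝ)
  have hS : 0 ≤ S := tsum_nonneg fun n => by positivity
  refine ⟨2 + S, by positivity, fun s hs hs1 => ?_⟩
  have hne : s ≠ 1 := by rintro rfl; norm_num at hs1
  have b0 : 0 ≤ ‖s‖ := norm_nonneg s
  have b1 : ‖1 - s‖ ≤ 1 + ‖s‖ := (norm_sub_le _ _).trans (by simp)
  have b1' : ‖s - 1‖ ≤ 1 + ‖s‖ := by rwa [norm_sub_rev]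
  have b2 : ‖s + 1‖ ≤ 1 + ‖s‖ := (norm_add_le _ _).trans (by simp [add_comm])
  have hts : ‖∑' n, trapezoidTerm s n‖ ≤ ‖1 - s‖ * ‖s‖ * ‖s + 1‖ * S :=
    tsum_of_norm_bounded (summable_natCast_add_one_rpow.hasSum.mul_left _)
      (fun n => norm_trapezoidTerm_le hs.le n)
  have h1 : ‖riemannZeta₁ s‖ ≤ (1 + ‖s‖) / 2 + 1 + (1 + ‖s‖) ^ 3 * S := by
    rw [riemannZeta₁_eq_sub_tsum_trapezoidTerm hs]
    refine (norm_sub_le _ _).trans (add_le_add ((norm_add_le _ _).trans ?_) (hts.trans ?_))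
    · simp only [norm_div, norm_ofNat, norm_one]
      gcongr
    · calc ‖1 - s‖ * ‖s‖ * ‖s + 1‖ * S ≤ (1 + ‖s‖) * (1 + ‖s‖) * (1 + ‖s‖) * S := by
            gcongr
            linarith
        _ = _ := by ring
  have h2 : ‖riemannZeta s‖ ≤ ‖riemannZeta₁ s‖ := by
    rw [riemannZeta_eq_inv_sub_mul hne, norm_mul, norm_inv]
    exact mul_le_of_le_one_left (norm_nonneg _) (inv_le_one_of_one_le₀ hs1)
  have h3 : (1 : ℝ) ≤ (1 + ‖s‖) ^ 3 := one_le_pow₀ (by linarith)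
  have h4 : 1 + ‖s‖ ≤ (1 + ‖s‖) ^ 3 := le_self_pow₀ (by linarith) (by norm_num)
  nlinarith

/-! ### Three circles and logarithms of nonvanishing functions -/

/-- **Hadamard three circles theorem**. -/
theorem norm_le_interp_of_three_circles {f : ℂ → ℂ} {r₁ r₃ R a b : ℝ} (hr₁ : 0 < r₁)
    (hr : r₁ < r₃) (hR : r₃ < R) (hf : DifferentiableOn ℂ f (ball 0 R))
    (ha : ∀ z : ℂ, ‖z‖ = r₁ → ‖f z‖ ≤ a) (hb : ∀ z : ℂ, ‖z‖ = r₃ → ‖f z‖ ≤ b)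
    {z : ℂ} (hz₁ : r₁ ≤ ‖z‖) (hz₃ : ‖z‖ ≤ r₃) :
    ‖f z‖ ≤ a ^ (1 - Real.log (‖z‖ / r₁) / Real.log (r₃ / r₁)) *
      b ^ (Real.log (‖z‖ / r₁) / Real.log (r₃ / r₁)) := by
  have hz0 : z ≠ 0 := norm_pos_iff.1 (hr₁.trans_le hz₁)
  have hr₃ : 0 < r₃ := hr₁.trans hr
  have hlog : Real.log r₁ < Real.log r₃ := Real.log_lt_log hr₁ hr
  have hmaps : ∀ w ∈ HadamardThreeLines.verticalClosedStrip (Real.log r₁) (Real.log r₃),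
      exp w ∈ closedBall (0 : ℂ) r₃ := by
    intro w hw
    rw [mem_closedBall_zero_iff, norm_exp, ← Real.exp_log hr₃]
    exact Real.exp_le_exp.2 hw.2
  have hdiff : ∀ w ∈ HadamardThreeLines.verticalClosedStrip (Real.log r₁) (Real.log r₃),
      DifferentiableAt ℂ (fun w => f (exp w)) w := by
    intro w hw
    have : DifferentiableAt ℂ f (exp w) :=
      hf.differentiableAt (isOpen_ball.mem_nhds (closedBall_subset_ball hR (hmaps w hw)))
    exact this.comp w differentiableAt_exp
  -- The exponential turns vertical lines into circles, so the three lines theorem applies to `f ∘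
  -- exp`.
  have key := HadamardThreeLines.norm_le_interp_of_mem_verticalClosedStrip'
    (f := fun w => f (exp w)) (z := log z) (a := a) (b := b) hlog ?_ ?_ ?_ ?_ ?_
  · have e : (log z).re = Real.log ‖z‖ := log_re z
    rw [Real.log_div (hr₁.trans_le hz₁).ne' hr₁.ne', Real.log_div hr₃.ne' hr₁.ne', ← e]
    simpa only [exp_log hz0] using key
  · simp only [HadamardThreeLines.verticalClosedStrip, mem_preimage, log_re, mem_Icc]
    exact ⟨Real.log_le_log hr₁ hz₁, Real.log_le_log (hr₁.trans_le hz₁) hz₃⟩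
  · refine DifferentiableOn.diffContOnCl fun w hw => (hdiff w ?_).differentiableWithinAt
    have hcl : IsClosed (HadamardThreeLines.verticalClosedStrip (Real.log r₁) (Real.log r₃)) :=
      isClosed_Icc.preimage continuous_re
    exact closure_minimal (preimage_mono Ioo_subset_Icc_self) hcl hw
  · have hc : IsCompact (closedBall (0 : ℂ) r₃) := isCompact_closedBall _ _
    have := (hc.image_of_continuousOn
      ((hf.continuousOn.mono (closedBall_subset_ball hR)).norm)).bddAbove
    refine this.mono ?_
    rintro _ ⟨w, hw, rfl⟩
    exact ⟨exp w, hmaps w hw, rfl⟩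
  · intro w hw
    refine ha _ ?_
    rw [norm_exp, show w.re = Real.log r₁ from hw, Real.exp_log hr₁]
  · intro w hw
    refine hb _ ?_
    rw [norm_exp, show w.re = Real.log r₃ from hw, Real.exp_log hr₃]

/-- Since `a ≤ b`, the interpolated bound increases with the radius, so the bound at radius `r₂`
serves the whole disc. -/
theorem norm_le_interp_of_closedBall {f : ℂ → ℂ} {r₁ r₂ r₃ R a b : ℝ} (hr₁ : 0 < r₁)
    (h₁₂ : r₁ < r₂) (h₂₃ : r₂ < r₃) (hR : r₃ < R) (hf : DifferentiableOn ℂ f (ball 0 R))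
    (ha0 : 0 < a) (hab : a ≤ b)
    (ha : ∀ z : ℂ, ‖z‖ ≤ r₁ → ‖f z‖ ≤ a) (hb : ∀ z : ℂ, ‖z‖ ≤ r₃ → ‖f z‖ ≤ b)
    {z : ℂ} (hz : ‖z‖ ≤ r₂) :
    ‖f z‖ ≤ a ^ (1 - Real.log (r₂ / r₁) / Real.log (r₃ / r₁)) *
      b ^ (Real.log (r₂ / r₁) / Real.log (r₃ / r₁)) := by
  have hb0 : 0 < b := ha0.trans_le hab
  have hl₃ : 0 < Real.log (r₃ / r₁) := Real.log_pos ((one_lt_div hr₁).2 (h₁₂.trans h₂₃))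
  have hl₂ : 0 < Real.log (r₂ / r₁) := Real.log_pos ((one_lt_div hr₁).2 h₁₂)
  have hform : ∀ t : ℝ, a ^ (1 - t) * b ^ t = a * (b / a) ^ t := by
    intro t
    rw [Real.rpow_sub ha0, Real.div_rpow hb0.le ha0.le, Real.rpow_one]
    ring
  have hba : 1 ≤ b / a := (one_le_div ha0).2 hab
  rw [hform]
  rcases le_or_gt ‖z‖ r₁ with h | h
  · exact (ha z h).trans (le_mul_of_one_le_right ha0.le (Real.one_le_rpow hba (by positivity)))
  · have := norm_le_interp_of_three_circles hr₁ (h₁₂.trans h₂₃) hR hf (fun z hz => ha z hz.le)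
      (fun z hz => hb z hz.le) h.le (hz.trans h₂₃.le)
    rw [hform] at this
    refine this.trans ?_
    have : ‖z‖ / r₁ ≤ r₂ / r₁ := by gcongr
    have h0 : 0 < ‖z‖ / r₁ := div_pos (hr₁.trans h) hr₁
    gcongr

/-- A primitive of `g'/g` normalised at `0` works, because `g * exp (-f)` has zero derivative. The
principal value at `0` keeps `‖f 0‖` under control. -/
theorem exists_log_of_ne_zero_on_ball {g : ℂ → ℂ} {R : ℝ} (hR : 0 < R)
    (hg : DifferentiableOn ℂ g (ball 0 R)) (h0 : ∀ z ∈ ball (0 : ℂ) R, g z ≠ 0) :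
    ∃ f : ℂ → ℂ, DifferentiableOn ℂ f (ball 0 R) ∧ f 0 = log (g 0) ∧
      ∀ z ∈ ball (0 : ℂ) R, exp (f z) = g z := by
  have hg' : DifferentiableOn ℂ (deriv g) (ball 0 R) := hg.deriv isOpen_ball
  have hz0 : (0 : ℂ) ∈ ball (0 : ℂ) R := mem_ball_self hR
  obtain ⟨f, hf0, hf⟩ := (hg'.div hg h0).isExactOn_ball.with_val_at 0 (log (g 0))
  refine ⟨f, fun z hz => (hf z hz).differentiableAt.differentiableWithinAt, hf0, ?_⟩
  have hd : ∀ z ∈ ball (0 : ℂ) R, HasDerivAt (fun z => g z * exp (-f z)) 0 z := by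
    intro z hz
    have h1 := (hg.differentiableAt (isOpen_ball.mem_nhds hz)).hasDerivAt
    have h2 := h1.mul ((hf z hz).neg.cexp)
    refine h2.congr_deriv ?_
    have := h0 z hz
    change deriv g z * exp (-f z) + g z * (exp (-f z) * -(deriv g z / g z)) = 0
    field_simp
    ring
  have hc : ∀ z ∈ ball (0 : ℂ) R, g z * exp (-f z) = 1 := by
    intro z hz
    have h1 := (convex_ball (0 : ℂ) R).norm_image_sub_le_of_norm_hasDerivWithin_le (C := 0)
      (fun z hz => (hd z hz).hasDerivWithinAt) (fun z _ => by simp) hz0 hz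
    rw [zero_mul, norm_le_zero_iff, sub_eq_zero] at h1
    rw [h1, hf0, exp_neg, exp_log (h0 0 hz0), mul_inv_cancel₀ (h0 0 hz0)]
  intro z hz
  have := hc z hz
  rw [exp_neg] at this
  exact (mul_inv_eq_one₀ (exp_ne_zero _)).1 this |>.symm

/-- Borel–Carathéodory makes a logarithm of `g` bounded near the centre and `O(L)` on a larger disc.
Three circles then gives `O(L^θ)` with `θ < 1` in between, which is below `ε * L` for large `L`,
uniformly in `g`. -/
theorem abs_log_norm_le_of_ne_zero_on_ball {r ρ R A B ε : ℝ} (hr : 0 < r) (hrρ : r < ρ)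
    (hρR : ρ < R) (hA : 0 < A) (hB : 0 < B) (hε : 0 < ε) :
    ∃ L₀ : ℝ, ∀ L ≥ L₀, ∀ g : ℂ → ℂ, DifferentiableOn ℂ g (ball 0 R) →
      (∀ z ∈ ball (0 : ℂ) R, g z ≠ 0) → |Real.log ‖g 0‖| ≤ B →
      (∀ z ∈ ball (0 : ℂ) r, ‖g z‖ ≤ Real.exp B) →
      (∀ z ∈ ball (0 : ℂ) R, ‖g z‖ ≤ Real.exp (A * L)) →
      ∀ z : ℂ, ‖z‖ ≤ ρ → |Real.log ‖g z‖| ≤ ε * L := by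
  set r₃ := (ρ + R) / 2 with hr₃
  -- `C₁` is the Borel–Carathéodory bound at radius `r/2` in the disc of radius `r`. The second
  -- summand of `C₂` is the one at `r₃` in the disc of radius `R`, per unit of `L`.
  set C₁ : ℝ := 2 * B + 3 * (B + Real.pi) with hC₁
  set C₂ : ℝ := C₁ + (2 * A * r₃ / (R - r₃) + (B + Real.pi) * (R + r₃) / (R - r₃)) with hC₂
  set θ : ℝ := Real.log (ρ / (r / 2)) / Real.log (r₃ / (r / 2)) with hθ
  have hpi := Real.pi_pos
  have hr₃R : r₃ < R := by rw [hr₃]; linarith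
  have hρr₃ : ρ < r₃ := by rw [hr₃]; linarith
  have hr₃0 : 0 < r₃ := by linarith
  have hR0 : 0 < R := by linarith
  have hRr : 0 < R - r₃ := by linarith
  have hC₁0 : 0 < C₁ := by positivity
  have hC₁₂ : C₁ ≤ C₂ := le_add_of_nonneg_right (by positivity)
  have hC₂0 : 0 < C₂ := hC₁0.trans_le hC₁₂
  have hθ1 : θ < 1 := by
    have h1 : 1 < ρ / (r / 2) := (one_lt_div (by positivity)).2 (by linarith)
    rw [hθ, div_lt_one (Real.log_pos (h1.trans (by gcongr)))]
    exact Real.log_lt_log (by positivity) (by gcongr)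
  have hθ0 : 0 ≤ θ := by
    have h1 : 1 < ρ / (r / 2) := (one_lt_div (by positivity)).2 (by linarith)
    have h2 : 1 < r₃ / (r / 2) := (one_lt_div (by positivity)).2 (by linarith)
    exact div_nonneg (Real.log_pos h1).le (Real.log_pos h2).le
  have hev : ∀ᶠ L : ℝ in atTop, C₂ * L ^ (-(1 - θ)) ≤ ε := by
    have := (tendsto_rpow_neg_atTop (y := 1 - θ) (by linarith)).const_mul C₂
    rw [mul_zero] at this
    exact (this.eventually (gt_mem_nhds hε)).mono fun _ h => h.le
  obtain ⟨L₀, hL₀⟩ := eventually_atTop.1 (hev.and (eventually_ge_atTop 1))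
  refine ⟨L₀, fun L hL g hg hg0 hgB hin hout z hz => ?_⟩
  obtain ⟨hLε, hL1⟩ := hL₀ L hL
  have hL0 : 0 < L := by linarith
  obtain ⟨f, hf, hf0, hfg⟩ := exists_log_of_ne_zero_on_ball hR0 hg hg0
  have hre : ∀ z ∈ ball (0 : ℂ) R, (f z).re = Real.log ‖g z‖ := by
    intro z hz
    rw [← hfg z hz, norm_exp, Real.log_exp]
  have hfn : ‖f 0‖ ≤ B + Real.pi := by
    rw [hf0]
    refine (norm_le_abs_re_add_abs_im _).trans ?_
    rw [log_re, log_im]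
    exact add_le_add hgB (abs_arg_le_pi _)
  have hrR : r < R := by linarith
  have hinner : ∀ z : ℂ, ‖z‖ ≤ r / 2 → ‖f z‖ ≤ C₁ := by
    intro z hz
    have h := borelCaratheodory hB (hf.mono (ball_subset_ball hrR.le)) (fun w hw => ?_) hr
      (mem_ball_zero_iff.2 (by linarith : ‖z‖ < r))
    · have hd : r / 2 ≤ r - ‖z‖ := by linarith
      calc ‖f z‖ ≤ _ := h
        _ ≤ 2 * B * (r / 2) / (r / 2) + (B + Real.pi) * (r + r / 2) / (r / 2) := by gcongr
        _ = C₁ := by rw [hC₁]; field_simp; ring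
    · have hw' := ball_subset_ball hrR.le hw
      simp only [mem_ofPred_eq]
      rw [hre w hw', Real.log_le_iff_le_exp (norm_pos_iff.2 (hg0 w hw'))]
      exact hin w hw
  have houter : ∀ z : ℂ, ‖z‖ ≤ r₃ → ‖f z‖ ≤ C₂ * L := by
    intro z hz
    have h := borelCaratheodory (M := A * L) (by positivity) hf (fun w hw => ?_) hR0
      (mem_ball_zero_iff.2 (by linarith : ‖z‖ < R))
    · have hd : R - r₃ ≤ R - ‖z‖ := by linarith
      calc ‖f z‖ ≤ _ := h
        _ ≤ 2 * (A * L) * r₃ / (R - r₃) + (B + Real.pi) * (R + r₃) / (R - r₃) := by gcongr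
        _ ≤ 2 * (A * L) * r₃ / (R - r₃) + (B + Real.pi) * (R + r₃) / (R - r₃) * L := by
            gcongr
            exact le_mul_of_one_le_right (by positivity) hL1
        _ = (2 * A * r₃ / (R - r₃) + (B + Real.pi) * (R + r₃) / (R - r₃)) * L := by ring
        _ ≤ C₂ * L := by
            gcongr
            rw [hC₂]
            linarith
    · simp only [mem_ofPred_eq]
      rw [hre w hw, Real.log_le_iff_le_exp (norm_pos_iff.2 (hg0 w hw))]
      exact hout w hw
  have hmid := norm_le_interp_of_closedBall (by positivity : 0 < r / 2) (by linarith) hρr₃ hr₃R hf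
    hC₁0 (hC₁₂.trans (le_mul_of_one_le_right hC₂0.le hL1)) hinner houter hz
  rw [← hθ] at hmid
  rw [← hre z (mem_ball_zero_iff.2 (by linarith))]
  refine (abs_re_le_norm _).trans (hmid.trans ?_)
  calc C₁ ^ (1 - θ) * (C₂ * L) ^ θ ≤ C₂ ^ (1 - θ) * (C₂ * L) ^ θ := by
        gcongr
    _ = C₂ * L ^ (-(1 - θ)) * L := by
        rw [Real.mul_rpow hC₂0.le hL0.le, ← mul_assoc, ← Real.rpow_add hC₂0, sub_add_cancel,
          Real.rpow_one, mul_assoc, ← Real.rpow_add_one hL0.ne']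
        congr 2
        ring
    _ ≤ ε * L := by gcongr

/-! ### Zeta on discs about `2 + iτ` -/

theorem norm_LSeries_le {f : ℕ → ℂ} (hf : ∀ n, ‖f n‖ ≤ 1) {s : ℂ} (hs : 3 / 2 ≤ s.re) :
    ‖LSeries f s‖ ≤ ∑' n : ℕ, (n : ℝ) ^ (-(3 / 2) : ℝ) := by
  refine tsum_of_norm_bounded (Real.summable_nat_rpow.2 (by norm_num)).hasSum fun n => ?_
  rw [LSeries.norm_term_eq]
  rcases eq_or_ne n 0 with rfl | hn
  · simp only [if_true]
    positivity
  · rw [if_neg hn]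
    have hn1 : (1 : ℝ) ≤ n := by exact_mod_cast Nat.one_le_iff_ne_zero.2 hn
    calc ‖f n‖ / (n : ℝ) ^ s.re ≤ 1 / (n : ℝ) ^ (3 / 2 : ℝ) := by
          gcongr
          exact hf n
      _ = _ := by rw [Real.rpow_neg (by positivity), one_div]

/-- Both zeta and its inverse are Dirichlet series with coefficients bounded by `1`, the inverse
having the Möbius function as coefficients. -/
theorem exists_abs_log_norm_riemannZeta_le :
    ∃ B : ℝ, 0 < B ∧ ∀ s : ℂ, 3 / 2 ≤ s.re → |Real.log ‖riemannZeta s‖| ≤ B := by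
  set S := ∑' n : ℕ, (n : ℝ) ^ (-(3 / 2) : ℝ)
  have hS : 0 ≤ S := tsum_nonneg fun n => by positivity
  refine ⟨Real.log (S + 2), Real.log_pos (by linarith), fun s hs => ?_⟩
  have hs1 : 1 < s.re := by linarith
  have hz := LSeries_one_eq_riemannZeta hs1
  have h1 : ‖riemannZeta s‖ ≤ S := by
    rw [← hz]
    exact norm_LSeries_le (by simp) hs
  have h2 : ‖LSeries (fun n => ((ArithmeticFunction.moebius n : ℤ) : ℂ)) s‖ ≤ S := by
    refine norm_LSeries_le (fun n => ?_) hs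
    rw [norm_intCast]
    exact_mod_cast ArithmeticFunction.abs_moebius_le_one
  have h3 := congrArg norm (LSeries_one_mul_Lseries_moebius hs1)
  rw [hz, norm_mul, norm_one] at h3
  have hpos : 0 < ‖riemannZeta s‖ := norm_pos_iff.2 (riemannZeta_ne_zero_of_one_lt_re hs1)
  rw [abs_le]
  constructor
  · rw [← Real.log_inv]
    refine Real.log_le_log (by positivity) ?_
    rw [inv_le_iff_one_le_mul₀ (by linarith)]
    nlinarith
  · exact Real.log_le_log hpos (by linarith)

theorem sub_two_add_re_im_le {s : ℂ} {τ r : ℝ} (hs : ‖s - (2 + I * τ)‖ ≤ r) :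
    |s.re - 2| ≤ r ∧ |s.im - τ| ≤ r := by
  have h1 := (abs_re_le_norm (s - (2 + I * τ))).trans hs
  have h2 := (abs_im_le_norm (s - (2 + I * τ))).trans hs
  simp at h1 h2
  exact ⟨h1, h2⟩

/-- Radius `9/4` stays in `re s ≥ -1/4`, where the cubic bound holds; the fourth power of `τ`
absorbs the constant. -/
theorem exists_norm_riemannZeta_le_exp_log :
    ∃ T : ℝ, 4 ≤ T ∧ ∀ τ ≥ T, ∀ s : ℂ, ‖s - (2 + I * τ)‖ ≤ 9 / 4 →
      s ≠ 1 ∧ ‖riemannZeta s‖ ≤ Real.exp (4 * Real.log τ) := by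
  obtain ⟨C, hC, h⟩ := exists_norm_riemannZeta_le
  refine ⟨max 6 (27 * C), le_max_of_le_left (by norm_num), fun τ hτ s hs => ?_⟩
  have hτ6 : 6 ≤ τ := (le_max_left _ _).trans hτ
  have hτC : 27 * C ≤ τ := (le_max_right _ _).trans hτ
  obtain ⟨h1, h2⟩ := sub_two_add_re_im_le hs
  rw [abs_le] at h1 h2
  have hs1 : 1 ≤ ‖s - 1‖ := by
    refine le_trans ?_ (abs_im_le_norm (s - 1))
    simp only [sub_im, one_im, sub_zero]
    exact le_trans (by linarith) (le_abs_self _)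
  refine ⟨by rintro rfl; norm_num at hs1, (h s (by linarith) hs1).trans ?_⟩
  have hsn : 1 + ‖s‖ ≤ 3 * τ := by
    have := norm_le_abs_re_add_abs_im s
    rw [abs_of_nonneg (by linarith : 0 ≤ s.im)] at this
    have : |s.re| ≤ 17 / 4 := abs_le.2 ⟨by linarith, by linarith⟩
    linarith
  have hexp : Real.exp (4 * Real.log τ) = τ ^ 4 := by
    rw [mul_comm, Real.exp_mul, Real.exp_log (by linarith)]
    norm_cast
  rw [hexp]
  calc C * (1 + ‖s‖) ^ 3 ≤ C * (3 * τ) ^ 3 := by gcongr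
    _ = 27 * C * τ ^ 3 := by ring
    _ ≤ τ * τ ^ 3 := by gcongr
    _ = τ ^ 4 := by ring

theorem differentiableOn_riemannZeta_add_ball {c : ℂ} {R : ℝ}
    (h : ∀ s : ℂ, ‖s - c‖ ≤ R → s ≠ 1) :
    DifferentiableOn ℂ (fun z => riemannZeta (c + z)) (ball 0 R) := by
  intro z hz
  have h1 : c + z ≠ 1 := h _ (by simpa using (mem_ball_zero_iff.1 hz).le)
  have h2 : DifferentiableAt ℂ (fun z => c + z) z := by fun_prop
  exact (DifferentiableAt.comp z (differentiableAt_riemannZeta h1) h2).differentiableWithinAt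

/-- If the zeta function has no zeros in the disc of radius `R` about `2 + iτ`, then it is
`τ ^ o(1)`, and so is its inverse, on smaller concentric discs. -/
theorem exists_abs_log_norm_riemannZeta_le_of_ne_zero {ρ R ε : ℝ} (hρ : 1 / 2 < ρ) (hρR : ρ < R)
    (hR : R ≤ 9 / 4) (hε : 0 < ε) :
    ∃ T : ℝ, ∀ τ ≥ T, (∀ s : ℂ, ‖s - (2 + I * τ)‖ < R → riemannZeta s ≠ 0) →
      ∀ s : ℂ, ‖s - (2 + I * τ)‖ ≤ ρ → |Real.log ‖riemannZeta s‖| ≤ ε * Real.log τ := by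
  obtain ⟨T₁, hT₁, hpoly⟩ := exists_norm_riemannZeta_le_exp_log
  obtain ⟨B, hB, hBz⟩ := exists_abs_log_norm_riemannZeta_le
  obtain ⟨L₀, hL₀⟩ := abs_log_norm_le_of_ne_zero_on_ball (r := 1 / 2) (A := 4) (by norm_num) hρ hρR
    (by norm_num) hB hε
  refine ⟨max T₁ (Real.exp L₀), fun τ hτ hz s hs => ?_⟩
  have hτ₁ : T₁ ≤ τ := (le_max_left _ _).trans hτ
  have hτL : L₀ ≤ Real.log τ := by
    rw [Real.le_log_iff_exp_le (by linarith)]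
    exact (le_max_right _ _).trans hτ
  set c : ℂ := 2 + I * τ with hc
  have hnorm : ∀ z : ℂ, ‖c + z - c‖ = ‖z‖ := fun z => by rw [add_sub_cancel_left]
  have hdiff : DifferentiableOn ℂ (fun z => riemannZeta (c + z)) (ball 0 R) :=
    differentiableOn_riemannZeta_add_ball fun s hs => (hpoly τ hτ₁ s (hs.trans hR)).1
  have hre : ∀ z : ℂ, ‖z‖ < 1 / 2 → 3 / 2 ≤ (c + z).re := by
    intro z hz
    have h := (sub_two_add_re_im_le (s := c + z) (τ := τ) (r := 1 / 2)
      (by rw [hnorm]; exact hz.le)).1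
    linarith [(abs_le.1 h).1]
  have := hL₀ (Real.log τ) hτL (fun z => riemannZeta (c + z)) hdiff
    (fun z hz' => hz _ (by rw [hnorm]; exact mem_ball_zero_iff.1 hz'))
    (hBz _ (hre 0 (by simp))) (fun z hz' => ?_)
    (fun z hz' => (hpoly τ hτ₁ _ (by rw [hnorm]; linarith [mem_ball_zero_iff.1 hz'])).2) (s - c) hs
  · simpa using this
  · have h1 := hre z (mem_ball_zero_iff.1 hz')
    rw [← Real.log_le_iff_le_exp
      (norm_pos_iff.2 (riemannZeta_ne_zero_of_one_lt_re (by linarith)))]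
    exact (le_abs_self _).trans (hBz _ h1)

/-! ### The Lindelöf bound under RH -/

theorem RiemannHypothesis.re_eq_of_im_pos (hRH : RiemannHypothesis) {s : ℂ}
    (hs : riemannZeta s = 0) (him : 0 < s.im) : s.re = 1 / 2 := by
  refine hRH s hs ?_ ?_
  · rintro ⟨n, rfl⟩
    simp at him
  · rintro rfl
    simp at him

/-- The Lindelöf bound, slightly to the left of the critical line. -/
theorem RiemannHypothesis.exists_norm_riemannZeta_le (hRH : RiemannHypothesis) {ε : ℝ}
    (hε : 0 < ε) :
    ∃ δ : ℝ, 0 < δ ∧ ∃ T : ℝ, ∀ τ ≥ T, ∀ s : ℂ, ‖s - (2 + I * τ)‖ ≤ 3 / 2 + δ →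
      ‖riemannZeta s‖ ≤ τ ^ ε := by
  have hl : 0 < Real.log (4 / 3) := Real.log_pos (by norm_num)
  -- Capping `ε` at `1` ensures `τ ^ (ε' / 2) ≤ τ ^ 4`, as the interpolation requires.
  set ε' := min ε 1 with hε'
  have hε'0 : 0 < ε' := lt_min hε one_pos
  have hε'1 : ε' ≤ 1 := min_le_right _ _
  -- Crossing the line from radius `3/2 - δ` to `3/2 + δ` gives an interpolation weight `θ ≤ 2δ /
  -- log (4/3) ≤ ε'/8`, so the bound `τ ^ 4` on the outer disc costs at most `τ ^ (ε'/2)`.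
  set δ := min (1 / 4) (ε' * Real.log (4 / 3) / 16) with hδ
  have hδ0 : 0 < δ := lt_min (by norm_num) (by positivity)
  have hδ4 : δ ≤ 1 / 4 := min_le_left _ _
  have hδε : δ ≤ ε' * Real.log (4 / 3) / 16 := min_le_right _ _
  obtain ⟨T₁, hT₁, hpoly⟩ := exists_norm_riemannZeta_le_exp_log
  obtain ⟨T₂, hT₂⟩ := exists_abs_log_norm_riemannZeta_le_of_ne_zero (ρ := 3 / 2 - δ)
    (R := 3 / 2) (ε := ε' / 2) (by linarith) (by linarith) (by norm_num) (by positivity)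
  refine ⟨δ, hδ0, max T₁ T₂, fun τ hτ s hs => ?_⟩
  have hτ₁ : T₁ ≤ τ := (le_max_left _ _).trans hτ
  have hτ₂ : T₂ ≤ τ := (le_max_right _ _).trans hτ
  have hτ0 : 0 < τ := by linarith
  have hτ1 : 1 ≤ τ := by linarith
  set c : ℂ := 2 + I * τ with hc
  have hnorm : ∀ z : ℂ, ‖c + z - c‖ = ‖z‖ := fun z => by rw [add_sub_cancel_left]
  have hfree : ∀ s : ℂ, ‖s - c‖ < 3 / 2 → riemannZeta s ≠ 0 := by
    intro s hs h0
    obtain ⟨h1, h2⟩ := sub_two_add_re_im_le hs.le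
    have h3 := hRH.re_eq_of_im_pos h0 (by linarith [(abs_le.1 h2).1])
    have h4 := (abs_re_le_norm (s - c)).trans_lt hs
    simp only [hc, sub_re, h3, add_re, re_ofNat, mul_re, I_re, ofReal_re, I_im, ofReal_im] at h4
    norm_num [abs_lt] at h4
  have hdiff : DifferentiableOn ℂ (fun z => riemannZeta (c + z)) (ball 0 (9 / 4)) :=
    differentiableOn_riemannZeta_add_ball fun s hs => (hpoly τ hτ₁ s hs).1
  have hexp : ∀ x : ℝ, Real.exp (x * Real.log τ) = τ ^ x := fun x => by
    rw [mul_comm, Real.rpow_def_of_pos hτ0]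
  have key := norm_le_interp_of_closedBall (f := fun z => riemannZeta (c + z))
    (r₁ := 3 / 2 - δ) (r₂ := 3 / 2 + δ) (r₃ := 2) (R := 9 / 4) (a := τ ^ (ε' / 2))
    (b := τ ^ (4 : ℝ)) (by linarith) (by linarith) (by linarith) (by norm_num) hdiff
    (by positivity) (Real.rpow_le_rpow_of_exponent_le hτ1 (by linarith)) (fun z hz => ?_)
    (fun z hz => ?_) (z := s - c) hs
  · set θ := Real.log ((3 / 2 + δ) / (3 / 2 - δ)) / Real.log (2 / (3 / 2 - δ)) with hθ
    have hd : 1 < 3 / 2 - δ := by linarith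
    have hden : Real.log (4 / 3) ≤ Real.log (2 / (3 / 2 - δ)) := by
      refine Real.log_le_log (by norm_num) ?_
      rw [div_le_div_iff₀ (by norm_num) (by linarith)]
      linarith
    have hnum : Real.log ((3 / 2 + δ) / (3 / 2 - δ)) ≤ 2 * δ := by
      refine (Real.log_le_sub_one_of_pos (by positivity)).trans ?_
      rw [sub_le_iff_le_add, div_le_iff₀ (by linarith)]
      nlinarith
    have hnum0 : 0 ≤ Real.log ((3 / 2 + δ) / (3 / 2 - δ)) :=
      Real.log_nonneg ((one_le_div (by linarith)).2 (by linarith))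
    have hθ0 : 0 ≤ θ := div_nonneg hnum0 (hl.le.trans hden)
    have hθε : 4 * θ ≤ ε' / 2 := by
      have : θ ≤ 2 * δ / Real.log (4 / 3) := div_le_div₀ (by positivity) hnum hl hden
      have h2 : 2 * δ / Real.log (4 / 3) ≤ ε' / 8 := by
        rw [div_le_iff₀ hl]
        linarith
      linarith
    simp only [add_sub_cancel] at key
    refine key.trans ?_
    rw [← Real.rpow_mul hτ0.le, ← Real.rpow_mul hτ0.le, ← Real.rpow_add hτ0]
    refine Real.rpow_le_rpow_of_exponent_le hτ1 ?_
    have : ε' ≤ ε := min_le_left _ _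
    nlinarith
  · have h1 := hT₂ τ hτ₂ hfree (c + z) (by rwa [hnorm])
    rw [← hexp, ← Real.log_le_iff_le_exp (norm_pos_iff.2 (hfree _ (by rw [hnorm]; linarith)))]
    exact (le_abs_self _).trans h1
  · rw [← hexp]
    exact (hpoly τ hτ₁ _ (by rw [hnorm]; linarith)).2

/-! ### Zeros with ordinate in `(t/2, t)` -/

theorem normSq_Gamma_one_add_I_mul {y : ℝ} (hy : 0 < y) :
    ‖Complex.Gamma (1 + I * y)‖ ^ 2 = Real.pi * y / Real.sinh (Real.pi * y) := by
  have hI : I * (y : ℂ) ≠ 0 := mul_ne_zero I_ne_zero (by exact_mod_cast hy.ne')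
  have h1 : Complex.Gamma (1 + I * y) = I * y * Complex.Gamma (I * y) := by
    rw [add_comm, Complex.Gamma_add_one _ hI]
  have h2 : (starRingEnd ℂ) (Complex.Gamma (1 + I * y)) = Complex.Gamma (1 - I * y) := by
    rw [← Complex.Gamma_conj]
    simp [sub_eq_add_neg]
  have h3 : sin (Real.pi * (I * y)) = Real.sinh (Real.pi * y) * I := by
    rw [show (Real.pi : ℂ) * (I * y) = (Real.pi * y : ℝ) * I by push_cast; ring, sin_mul_I]
    push_cast
    rfl
  have hs : (Real.sinh (Real.pi * y) : ℂ) ≠ 0 := by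
    exact_mod_cast (Real.sinh_pos_iff.2 (by positivity)).ne'
  have h4 : ((‖Complex.Gamma (1 + I * y)‖ ^ 2 : ℝ) : ℂ) =
      ((Real.pi * y / Real.sinh (Real.pi * y) : ℝ) : ℂ) := by
    rw [ofReal_pow, ← mul_conj', h2, h1, mul_assoc, Complex.Gamma_mul_Gamma_one_sub, h3]
    push_cast
    push_cast at hs
    field_simp
  exact_mod_cast h4

/-- The functional equation between `re s = 0` and `re s = 1`, with the Gamma factor evaluated
exactly by reflection, so that Stirling's formula is not needed. -/
theorem norm_riemannZeta_neg_I_mul_sq {y : ℝ} (hy : 0 < y) :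
    ‖riemannZeta (-(I * y))‖ ^ 2 =
      y / (2 * Real.pi) * Real.tanh (Real.pi * y / 2) * ‖riemannZeta (1 + I * y)‖ ^ 2 := by
  have hs : ∀ n : ℕ, (1 + I * y : ℂ) ≠ -n := by
    intro n h
    have := congrArg im h
    simp at this
    exact hy.ne' this
  have hs1 : (1 + I * y : ℂ) ≠ 1 := by
    intro h
    have := congrArg im h
    simp at this
    exact hy.ne' this
  have hfe := riemannZeta_one_sub hs hs1
  rw [show (1 : ℂ) - (1 + I * y) = -(I * y) by ring] at hfe
  have hcos : cos (Real.pi * (1 + I * y) / 2) = -(Real.sinh (Real.pi * y / 2) * I) := by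
    rw [show (Real.pi : ℂ) * (1 + I * y) / 2 = (Real.pi * y / 2 : ℝ) * I + Real.pi / 2 by
      push_cast; ring, cos_add_pi_div_two, sin_mul_I]
    push_cast
    rfl
  have hpow : ‖(2 * Real.pi : ℂ) ^ (-(1 + I * y) : ℂ)‖ = (2 * Real.pi)⁻¹ := by
    rw [show (2 * Real.pi : ℂ) = ((2 * Real.pi : ℝ) : ℂ) by push_cast; rfl,
      norm_cpow_eq_rpow_re_of_pos (by positivity)]
    simp [Real.rpow_neg_one]
  have hsinh : 0 < Real.sinh (Real.pi * y / 2) := Real.sinh_pos_iff.2 (by positivity)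
  have hcosh : 0 < Real.cosh (Real.pi * y / 2) := Real.cosh_pos _
  rw [hfe, norm_mul, norm_mul, norm_mul, norm_mul, hpow, hcos, norm_neg, norm_mul, norm_I, norm_real,
    Real.norm_of_nonneg hsinh.le, norm_ofNat, mul_pow, mul_pow, mul_pow,
    normSq_Gamma_one_add_I_mul hy]
  have h2 : Real.sinh (Real.pi * y) =
      2 * Real.sinh (Real.pi * y / 2) * Real.cosh (Real.pi * y / 2) := by
    rw [← Real.sinh_two_mul]
    congr 1
    ring
  rw [h2, Real.tanh_eq_sinh_div_cosh]
  have hpi := Real.pi_pos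
  field_simp

/-- Under the Riemann hypothesis the critical line has a zero with ordinate in `(t / 2, t)`. -/
theorem RiemannHypothesis.exists_zero (hRH : RiemannHypothesis) :
    ∃ T : ℝ, ∀ t ≥ T, ∃ γ : ℝ, t / 2 < γ ∧ γ < t ∧ riemannZeta (1 / 2 + I * γ) = 0 := by
  -- Radius `2` reaches `iτ`. With exponent `1/8` the squared ratio of the values at `iτ` and `1 +
  -- iτ` is at most `τ ^ (1/2)`, whereas the functional equation makes it at least `τ / 16`.
  obtain ⟨T₁, hT₁⟩ := exists_abs_log_norm_riemannZeta_le_of_ne_zero (ρ := 2) (R := 9 / 4)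
    (ε := 1 / 8) (by norm_num) (by norm_num) le_rfl (by norm_num)
  refine ⟨max (4 / 3 * T₁) (10000), fun t ht => ?_⟩
  by_contra! hno
  have ht₁ : 4 / 3 * T₁ ≤ t := (le_max_left _ _).trans ht
  have htl : 10000 ≤ t := (le_max_right _ _).trans ht
  obtain ⟨τ, hτ⟩ : ∃ τ : ℝ, τ = 3 / 4 * t := ⟨_, rfl⟩
  have hτ0 : 0 < τ := by linarith
  have hfree : ∀ s : ℂ, ‖s - (2 + I * τ)‖ < 9 / 4 → riemannZeta s ≠ 0 := by
    intro s hs h0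
    obtain ⟨-, h2⟩ := sub_two_add_re_im_le hs.le
    rw [abs_le] at h2
    have h3 := hRH.re_eq_of_im_pos h0 (by linarith)
    refine hno s.im (by linarith) (by linarith) ?_
    rw [← h0]
    congr 1
    apply Complex.ext <;> simp [h3]
  have key := hT₁ τ (by linarith) hfree
  have h1 := key (1 + I * τ) (by norm_num [show (1 + I * τ : ℂ) - (2 + I * τ) = -1 by ring])
  have h0 := key (I * τ) (by norm_num [show (I * τ : ℂ) - (2 + I * τ) = -2 by ring])
  have hn1 : 0 < ‖riemannZeta (1 + I * τ)‖ := norm_pos_iff.2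
    (hfree _ (by norm_num [show (1 + I * τ : ℂ) - (2 + I * τ) = -1 by ring]))
  have hn0 : 0 < ‖riemannZeta (I * τ)‖ := norm_pos_iff.2
    (hfree _ (by norm_num [show (I * τ : ℂ) - (2 + I * τ) = -2 by ring]))
  have hconj : ‖riemannZeta (-(I * τ))‖ = ‖riemannZeta (I * τ)‖ := by
    rw [← norm_conj, ← riemannZeta_conj]
    simp
  have hfe := norm_riemannZeta_neg_I_mul_sq hτ0
  rw [hconj] at hfe
  have htanh : 1 / 2 ≤ Real.tanh (Real.pi * τ / 2) := by
    have hx : 2 ≤ Real.pi * τ / 2 := by nlinarith [Real.pi_gt_three]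
    rw [Real.tanh_eq_sinh_div_cosh, le_div_iff₀ (Real.cosh_pos _), Real.sinh_eq, Real.cosh_eq]
    set x := Real.pi * τ / 2
    have e1 : 3 ≤ Real.exp x := by linarith [Real.add_one_le_exp x]
    have e2 : Real.exp (-x) ≤ 1 := Real.exp_le_one_iff.2 (by linarith)
    linarith
  have hlow : τ / 16 * ‖riemannZeta (1 + I * τ)‖ ^ 2 ≤ ‖riemannZeta (I * τ)‖ ^ 2 := by
    rw [hfe]
    gcongr
    calc τ / 16 = τ / (2 * 4) * (1 / 2) := by ring
      _ ≤ τ / (2 * Real.pi) * Real.tanh (Real.pi * τ / 2) := by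
        gcongr
        exact Real.pi_le_four
  have hlog := Real.log_le_log (by positivity) hlow
  rw [Real.log_mul (by positivity) (by positivity), Real.log_div hτ0.ne' (by norm_num),
    Real.log_pow, Real.log_pow] at hlog
  push_cast at hlog
  have e3 := (abs_le.1 h1).1
  have e4 := (abs_le.1 h0).2
  have e5 : Real.log 16 < Real.log τ / 2 := by
    have : Real.log 16 * 2 < Real.log τ := by
      have := Real.log_lt_log (by norm_num) (by linarith : (16 : ℝ) ^ 2 < τ)
      rw [Real.log_pow] at this
      push_cast at this
      linarith
    linarith
  linarith

/-! ### The Hardy function and the analytic continuation of its square -/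

theorem norm_siegelPhase (t : ℝ) : ‖siegelPhase t‖ = 1 := by
  have hG : Complex.Gamma (1 / 4 + I * t / 2) ≠ 0 := by
    refine Complex.Gamma_ne_zero_of_re_pos ?_
    simp
  rw [siegelPhase, norm_mul, norm_cpow_eq_rpow_re_of_pos Real.pi_pos, norm_div, norm_real,
    norm_norm, div_self (norm_ne_zero_iff.2 hG)]
  simp

/-- Without differentiability, `deriv hardyZ t = 0` could be the default value and would say nothing
about the derivative of `Z²`. -/
theorem differentiableAt_hardyZ (t : ℝ) : DifferentiableAt ℝ hardyZ t := by
  have hG : Complex.Gamma (1 / 4 + I * t / 2) ≠ 0 := by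
    refine Complex.Gamma_ne_zero_of_re_pos ?_
    simp
  have e : hardyZ = fun t : ℝ => Real.pi ^ (1 / 4 : ℝ) / ‖Complex.Gamma (1 / 4 + I * t / 2)‖ *
      (completedRiemannZeta (1 / 2 + I * t)).re := by
    funext t
    rw [hardyZ, siegelPhase_mul_zeta_eq, re_ofReal_mul]
  have hofr : DifferentiableAt ℝ (fun y : ℝ => (y : ℂ)) t := ofRealCLM.differentiableAt
  have d1 : DifferentiableAt ℝ (fun t : ℝ => Complex.Gamma (1 / 4 + I * t / 2)) t := by
    have h : DifferentiableAt ℂ Complex.Gamma (1 / 4 + I * t / 2) := by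
      refine Complex.differentiableAt_Gamma _ fun m h => ?_
      have := congrArg re h
      simp at this
      linarith [Nat.cast_nonneg (α := ℝ) m]
    have h2 : DifferentiableAt ℝ (fun t : ℝ => (1 / 4 + I * t / 2 : ℂ)) t := by fun_prop
    exact DifferentiableAt.comp t (h.restrictScalars ℝ) h2
  have d2 : DifferentiableAt ℝ (fun t : ℝ => completedRiemannZeta (1 / 2 + I * t)) t := by
    have h : DifferentiableAt ℂ completedRiemannZeta (1 / 2 + I * t) := by
      refine differentiableAt_completedZeta (fun h => ?_) (fun h => ?_)
      · have := congrArg re h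
        simp at this
      · have := congrArg re h
        norm_num at this
    have h2 : DifferentiableAt ℝ (fun t : ℝ => (1 / 2 + I * t : ℂ)) t := by fun_prop
    exact DifferentiableAt.comp t (h.restrictScalars ℝ) h2
  rw [e]
  have hn : ‖Complex.Gamma (1 / 4 + I * t / 2)‖ ≠ 0 := norm_ne_zero_iff.2 hG
  exact ((differentiableAt_const _).div (d1.norm ℝ hG) hn).mul
    (reCLM.differentiableAt.comp t d2)

/-- The analytic continuation of `Z(t)² = |ζ(1/2 + it)|²`. -/
noncomputable def hardySq (z : ℂ) : ℂ :=
  riemannZeta (1 / 2 + I * z) * riemannZeta (1 / 2 - I * z)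

/-- Schwarz reflection lets one bound for zeta near the critical line control both factors of
`hardySq`. -/
theorem riemannZeta_half_sub_I_mul (z : ℂ) :
    riemannZeta (1 / 2 - I * z) =
      (starRingEnd ℂ) (riemannZeta (1 / 2 + I * (starRingEnd ℂ) z)) := by
  rw [← riemannZeta_conj]
  congr 1
  simp [sub_eq_add_neg, map_ofNat (starRingEnd ℂ) 2]

theorem hardySq_ofReal (t : ℝ) : hardySq t = (hardyZ t : ℂ) ^ 2 := by
  have h1 : hardySq t = ((‖riemannZeta (1 / 2 + I * t)‖ ^ 2 : ℝ) : ℂ) := by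
    rw [hardySq, riemannZeta_half_sub_I_mul, conj_ofReal, mul_conj']
    push_cast
    rfl
  have h2 : ‖riemannZeta (1 / 2 + I * t)‖ = |hardyZ t| := by
    have := congrArg norm (hardyZ_eq t)
    rwa [norm_mul, norm_siegelPhase, one_mul, norm_real, Real.norm_eq_abs, eq_comm] at this
  rw [h1, h2, sq_abs]
  push_cast
  rfl

theorem differentiableAt_hardySq {z : ℂ} (hz : 0 < z.re) : DifferentiableAt ℂ hardySq z := by
  have h1 : DifferentiableAt ℂ (fun z => riemannZeta (1 / 2 + I * z)) z := by
    refine DifferentiableAt.comp z (differentiableAt_riemannZeta fun h => ?_)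
      (f := fun z => 1 / 2 + I * z) (by fun_prop)
    have := congrArg im h
    simp at this
    exact hz.ne' this
  have h2 : DifferentiableAt ℂ (fun z => riemannZeta (1 / 2 - I * z)) z := by
    refine DifferentiableAt.comp z (differentiableAt_riemannZeta fun h => ?_)
      (f := fun z => 1 / 2 - I * z) (by fun_prop)
    have := congrArg im h
    simp at this
    exact hz.ne' this
  exact h1.mul h2

theorem hasDerivAt_hardySq_iterate {t : ℝ} (ht : 0 < t) (k : ℕ) :
    HasDerivAt (fun x : ℝ => iteratedDeriv k hardySq x) (iteratedDeriv (k + 1) hardySq t) t := by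
  have ho : IsOpen {z : ℂ | 0 < z.re} := isOpen_lt continuous_const continuous_re
  have ha : AnalyticAt ℂ hardySq t := by
    refine DifferentiableOn.analyticAt (s := {z : ℂ | 0 < z.re})
      (fun z hz => (differentiableAt_hardySq hz).differentiableWithinAt) (ho.mem_nhds ?_)
    simpa using ht
  have h := (ha.iterated_deriv k).differentiableAt.hasDerivAt
  rw [← iteratedDeriv_eq_iterate] at h
  rw [iteratedDeriv_succ]
  exact h.comp_ofReal

/-- `(Z²)' = 2ZZ'` vanishes at zeros and at critical points of `Z` alike. -/
theorem iteratedDeriv_one_hardySq_eq_zero {t : ℝ} (ht : 0 < t)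
    (h : hardyZ t = 0 ∨ deriv hardyZ t = 0) : iteratedDeriv 1 hardySq t = 0 := by
  have h1 := hasDerivAt_hardySq_iterate ht 0
  simp only [iteratedDeriv_zero, zero_add, hardySq_ofReal] at h1
  have h2 := ((differentiableAt_hardyZ t).hasDerivAt.ofReal_comp).pow 2
  have h3 := h1.unique h2
  rw [h3]
  rcases h with h | h <;> simp [h]

/-- Cauchy's estimate on a circle about `t`. The circle corresponds to points on both sides of the
critical line, hence the need for a Lindelöf bound beyond it. -/
theorem RiemannHypothesis.exists_norm_iteratedDeriv_hardySq_le (hRH : RiemannHypothesis) {ε : ℝ}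
    (hε : 0 < ε) :
    ∃ C : ℝ, 0 < C ∧ ∃ T : ℝ, ∀ t : ℝ, T ≤ t → ‖iteratedDeriv 3 hardySq t‖ ≤ C * t ^ ε := by
  obtain ⟨δ₀, hδ₀, T, hT⟩ := hRH.exists_norm_riemannZeta_le (half_pos hε)
  set δ := min δ₀ 1 with hδ
  have hδ0 : 0 < δ := lt_min hδ₀ one_pos
  have hδ1 : δ ≤ 1 := min_le_right _ _
  have hδδ : δ ≤ δ₀ := min_le_left _ _
  refine ⟨6 / δ ^ 3, by positivity, max T 2, fun t ht => ?_⟩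
  have htT : T ≤ t := (le_max_left _ _).trans ht
  have ht2 : 2 ≤ t := (le_max_right _ _).trans ht
  have hζ : ∀ z : ℂ, ‖z - t‖ ≤ δ → ‖riemannZeta (1 / 2 + I * z)‖ ≤ t ^ (ε / 2) := by
    intro z hz
    refine hT t htT _ ?_
    rw [show 1 / 2 + I * z - (2 + I * t) = -(3 / 2 : ℂ) + I * (z - t) by ring]
    refine (norm_add_le _ _).trans (add_le_add ?_ ?_)
    · rw [norm_neg]
      norm_num
    · rw [norm_mul, norm_I, one_mul]
      exact hz.trans hδδ
  have hd : DiffContOnCl ℂ hardySq (ball (t : ℂ) δ) := by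
    refine DifferentiableOn.diffContOnCl fun z hz => ?_
    refine (differentiableAt_hardySq ?_).differentiableWithinAt
    have h1 : ‖z - t‖ ≤ δ := mem_closedBall_iff_norm.1 (closure_ball_subset_closedBall hz)
    have h2 := (abs_le.1 ((abs_re_le_norm (z - t)).trans h1)).1
    simp at h2
    linarith
  have h := norm_iteratedDeriv_le_of_forall_mem_sphere_norm_le 3 hδ0 hd (C := t ^ ε)
    (fun z hz => ?_)
  · refine h.trans (le_of_eq ?_)
    norm_num [Nat.factorial]
    ring
  · have hz' : ‖z - t‖ ≤ δ := (mem_sphere_iff_norm.1 hz).le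
    rw [hardySq, norm_mul, riemannZeta_half_sub_I_mul, norm_conj]
    have h2 := hζ ((starRingEnd ℂ) z) (by
      rw [← norm_conj]
      simpa using hz')
    calc _ ≤ t ^ (ε / 2) * t ^ (ε / 2) := by
          gcongr
          exact hζ z hz'
      _ = t ^ ε := by
          rw [← Real.rpow_add (by linarith)]
          congr 1
          ring

/-! ### Hermite estimate and conclusion -/

theorem norm_le_of_hermite_zeros {f₀ f₁ f₂ f₃ : ℝ → ℂ} {a b K : ℝ}
    (h₀ : ∀ x ∈ uIcc a b, HasDerivAt f₀ (f₁ x) x) (h₁ : ∀ x ∈ uIcc a b, HasDerivAt f₁ (f₂ x) x)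
    (h₂ : ∀ x ∈ uIcc a b, HasDerivAt f₂ (f₃ x) x) (hK : ∀ x ∈ uIcc a b, ‖f₃ x‖ ≤ K)
    (ha₀ : f₀ a = 0) (ha₁ : f₁ a = 0) (hb₁ : f₁ b = 0) : ‖f₀ b‖ ≤ 2 * K * |b - a| ^ 3 := by
  rcases eq_or_ne a b with rfl | hab
  · simp [ha₀]
  set D := |b - a| with hD
  have hD0 : 0 < D := abs_pos.2 (sub_ne_zero.2 hab.symm)
  have hK0 : 0 ≤ K := (norm_nonneg _).trans (hK a left_mem_uIcc)
  have hcv : Convex ℝ (uIcc a b) := convex_uIcc a b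
  have hle : ∀ x ∈ uIcc a b, |x - a| ≤ D := fun x hx => abs_sub_left_of_mem_uIcc hx
  have mvt : ∀ (f f' : ℝ → ℂ) (M : ℝ), 0 ≤ M → (∀ x ∈ uIcc a b, HasDerivAt f (f' x) x) →
      (∀ x ∈ uIcc a b, ‖f' x‖ ≤ M) → ∀ x ∈ uIcc a b, ‖f x - f a‖ ≤ M * D := by
    intro f f' M hM hf hf' x hx
    refine (hcv.norm_image_sub_le_of_norm_hasDerivWithin_le
      (fun x hx => (hf x hx).hasDerivWithinAt) hf' left_mem_uIcc hx).trans ?_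
    rw [Real.norm_eq_abs]
    gcongr
    exact hle x hx
  have s₂ := mvt f₂ f₃ K hK0 h₂ hK
  -- Rolle's theorem fails for complex values. Subtracting the linear part of `f₁` at `a` and using
  -- `f₁ a = f₁ b = 0` bounds `f₂ a` instead.
  have s₁ := mvt (fun x => f₁ x - x * f₂ a) (fun x => f₂ x - f₂ a) (K * D) (by positivity)
    (fun x hx => by
      have h := (h₁ x hx).sub ((ofRealCLM.hasDerivAt (x := x)).mul_const (f₂ a))
      simpa using! h) s₂ b right_mem_uIcc
  have hfa : ‖f₂ a‖ ≤ K * D := by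
    have e : f₁ b - b * f₂ a - (f₁ a - a * f₂ a) = -(((b - a : ℝ) : ℂ) * f₂ a) := by
      rw [ha₁, hb₁]
      push_cast
      ring
    rw [e, norm_neg, norm_mul, norm_real, Real.norm_eq_abs, ← hD, mul_comm] at s₁
    exact le_of_mul_le_mul_right s₁ hD0
  have b₂ : ∀ x ∈ uIcc a b, ‖f₂ x‖ ≤ 2 * K * D := by
    intro x hx
    have := norm_le_norm_sub_add (f₂ x) (f₂ a)
    linarith [s₂ x hx]
  have b₁ : ∀ x ∈ uIcc a b, ‖f₁ x‖ ≤ 2 * K * D * D := by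
    intro x hx
    simpa [ha₁] using mvt f₁ f₂ _ (by positivity) h₁ b₂ x hx
  have b₀ := mvt f₀ f₁ _ (by positivity) h₀ b₁ b right_mem_uIcc
  rw [ha₀, sub_zero] at b₀
  refine b₀.trans (le_of_eq ?_)
  ring

theorem RiemannHypothesis.exists_norm_riemannZeta_sq_le (hRH : RiemannHypothesis) {ε : ℝ}
    (hε : 0 < ε) :
    ∃ C : ℝ, 0 < C ∧ ∃ T : ℝ, ∀ t γ : ℝ, T ≤ t → |t - γ| ≤ 1 →
      riemannZeta (1 / 2 + I * γ) = 0 → deriv hardyZ t = 0 →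
      ‖riemannZeta (1 / 2 + I * t)‖ ^ 2 ≤ C * t ^ ε * |t - γ| ^ 3 := by
  obtain ⟨C, hC, T, hT⟩ := hRH.exists_norm_iteratedDeriv_hardySq_le hε
  refine ⟨2 * (C * 2 ^ ε), by positivity, max (T + 1) 2, fun t γ ht hd hγ hZ => ?_⟩
  have htT : T + 1 ≤ t := (le_max_left _ _).trans ht
  have ht2 : 2 ≤ t := (le_max_right _ _).trans ht
  have hZγ : hardyZ γ = 0 := by rw [hardyZ, hγ, mul_zero, zero_re]
  have hmem : ∀ x ∈ uIcc γ t, |x - t| ≤ 1 := fun x hx =>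
    (abs_sub_comm x t ▸ abs_sub_right_of_mem_uIcc hx).trans hd
  have hb : ∀ x ∈ uIcc γ t, t - 1 ≤ x ∧ x ≤ t + 1 := fun x hx => by
    have := abs_le.1 (hmem x hx)
    constructor <;> linarith
  have hpos : ∀ x ∈ uIcc γ t, 0 < x := fun x hx => by linarith [(hb x hx).1]
  have h := norm_le_of_hermite_zeros (a := γ) (b := t) (K := C * (2 * t) ^ ε)
    (fun x hx => hasDerivAt_hardySq_iterate (hpos x hx) 0)
    (fun x hx => hasDerivAt_hardySq_iterate (hpos x hx) 1)
    (fun x hx => hasDerivAt_hardySq_iterate (hpos x hx) 2)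
    (fun x hx => (hT x (by linarith [(hb x hx).1])).trans (by
      have h1 := hpos x hx
      have h2 : x ≤ 2 * t := by linarith [(hb x hx).2]
      gcongr))
    (by rw [iteratedDeriv_zero, hardySq, hγ, zero_mul])
    (iteratedDeriv_one_hardySq_eq_zero (hpos γ left_mem_uIcc) (Or.inl hZγ))
    (iteratedDeriv_one_hardySq_eq_zero (by linarith) (Or.inr hZ))
  rw [iteratedDeriv_zero, hardySq, riemannZeta_half_sub_I_mul, conj_ofReal, norm_mul, norm_conj,
    ← sq, Real.mul_rpow (by norm_num) (by linarith)] at h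
  refine h.trans (le_of_eq ?_)
  ring

theorem theorem1 (hRH : RiemannHypothesis) (α : ℝ) (hα : 0 < α) :
    ∃ T : ℝ, ∀ t₀ γ' γ'' : ℝ, T ≤ t₀ →
      NeighboringZetaZeros γ' γ'' → γ' < t₀ → t₀ < γ'' →
      deriv hardyZ t₀ = 0 →
      ‖riemannZeta (1 / 2 + Complex.I * t₀)‖ > 1 / t₀ ^ α →
      min (t₀ - γ') (γ'' - t₀) > 1 / γ' ^ α := by
  obtain ⟨C, hC, T₁, hT₁⟩ := hRH.exists_norm_riemannZeta_sq_le (half_pos hα)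
  obtain ⟨T₂, hT₂⟩ := hRH.exists_zero
  -- Of the spare factor `t ^ α` between `t ^ (-2α)` and `t ^ (-3α)`, half pays for the Lindelöf
  -- loss and half beats this constant; `2 ^ (3α)` is the cube of the loss from `γ' ≥ t/2`.
  have hev : ∀ᶠ t : ℝ in atTop, C * 2 ^ (3 * α) < t ^ (α / 2) :=
    (tendsto_rpow_atTop (half_pos hα)).eventually_gt_atTop _
  obtain ⟨T₃, hT₃⟩ := eventually_atTop.1 hev
  refine ⟨max (max T₁ T₂) (max T₃ 2), fun t γ' γ'' ht hN hγ' hγ'' hZ hbig => ?_⟩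
  have ht₁ : T₁ ≤ t := (le_max_left _ _).trans ((le_max_left _ _).trans ht)
  have ht₂ : T₂ ≤ t := (le_max_right _ _).trans ((le_max_left _ _).trans ht)
  have ht₃ := hT₃ t ((le_max_left _ _).trans ((le_max_right _ _).trans ht))
  have htl : 2 ≤ t := (le_max_right _ _).trans ((le_max_right _ _).trans ht)
  have ht0 : 0 < t := by linarith
  obtain ⟨-, -, hz', hz'', hno⟩ := hN
  -- Otherwise the zero found in `(t/2, t)` would lie strictly between the neighbours.
  have hhalf : t / 2 ≤ γ' := by
    by_contra! hlt
    obtain ⟨γ, h1, h2, h3⟩ := hT₂ t ht₂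
    exact hno γ (by linarith) (by linarith) h3
  have hγle : 1 / γ' ^ α ≤ 1 / (t / 2) ^ α := by
    gcongr
  have hle1 : 1 / (t / 2) ^ α ≤ 1 := by
    rw [div_le_one (by positivity)]
    exact Real.one_le_rpow (by linarith) hα.le
  have main : ∀ γ : ℝ, riemannZeta (1 / 2 + I * γ) = 0 → 1 / γ' ^ α < |t - γ| := by
    intro γ hγ
    by_contra! hcon
    have hΔ : |t - γ| ≤ 1 / (t / 2) ^ α := hcon.trans hγle
    have h := hT₁ t γ ht₁ (hΔ.trans hle1) hγ hZ
    have hup : ‖riemannZeta (1 / 2 + I * t)‖ ^ 2 ≤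
        C * 2 ^ (3 * α) * (t ^ (α / 2) * t ^ (-(3 * α))) := by
      refine h.trans ?_
      calc C * t ^ (α / 2) * |t - γ| ^ 3 ≤ C * t ^ (α / 2) * (1 / (t / 2) ^ α) ^ 3 := by gcongr
        _ = _ := by
          rw [Real.div_rpow ht0.le (by norm_num), one_div_div, div_pow, Real.rpow_neg ht0.le,
            mul_comm 3 α, Real.rpow_mul (by norm_num), Real.rpow_mul ht0.le]
          norm_cast
          field_simp
    have hlow : t ^ (-(2 * α)) < ‖riemannZeta (1 / 2 + I * t)‖ ^ 2 := by
      have e : t ^ (-(2 * α)) = (1 / t ^ α) ^ 2 := by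
        rw [Real.rpow_neg ht0.le, mul_comm 2 α, Real.rpow_mul ht0.le]
        norm_cast
        rw [one_div, inv_pow]
      rw [e]
      gcongr
    have hlt : C * 2 ^ (3 * α) * (t ^ (α / 2) * t ^ (-(3 * α))) < t ^ (-(2 * α)) := by
      calc _ < t ^ (α / 2) * (t ^ (α / 2) * t ^ (-(3 * α))) := by gcongr
        _ = t ^ (-(2 * α)) := by
          rw [← Real.rpow_add ht0, ← Real.rpow_add ht0]
          congr 1
          ring
    linarith
  have m1 := main γ' hz'
  have m2 := main γ'' hz''
  rw [abs_of_pos (by linarith)] at m1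
  rw [abs_sub_comm, abs_of_pos (by linarith)] at m2
  exact lt_min m1 m2
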